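/- Let $\bar n,u,k,\bar d,l,\alpha,\beta$ be nonnegative integers, put $\bar k=\lfloor k/u\rfloor$ and $u_0=k-\bar k u$, and assume $0\le l<u$, $k\le \bar n u$ and $\bar d<\bar k$ (so $k\ge u$). Consider a rack-aware storage system of $\bar n$ racks with $u$ nodes each. A file of $B$ symbols over a finite alphabet is stored so that each node stores $\alpha$ symbols and, at every time, any $k$ nodes can retrieve the file. Nodes fail one at a time, arbitrarily often. When a node of rack $e$ fails, it is replaced by a node whose $\alpha$ symbols are a function of the contents of any $l$ surviving nodes of rack $e$ and of $\beta$ symbols received from each of any $\bar d$ helper racks other than $e$, where the $\beta$ symbols sent by a helper rack are a function of the contents of all its nodes; the other nodes are unchanged. (The replacement need not equal the lost node, it only has to keep the file retrievable from any $k$ nodes.) Then the maximum possible file size is $$B^*=(\bar k l+\min\{u_0,l\})\,\alpha+(u-l)\sum_{i=1}^{\bar d}\min\{i\beta,\alpha\}.$$ This holds in each of the following senses. (1) $B^*$ is the largest $B$ such that for every finite sequence of repairs, known in advance, there are a finite alphabet with at least two symbols and coding functions that keep a file of $B$ symbols retrievable from any $k$ nodes at all times. (2) $B^*$ is the largest $B$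 such that over one finite alphabet with at least two symbols a file of $B$ symbols can be kept retrievable from any $k$ nodes forever, when the repairs are not known in advance. (3) $B^*$ is the minimum of $\mathrm{MinCut}(S,C)$ over all data collectors $C$ in the information flow graphs of all finite sequences of repairs. In such a graph the source $S$ is joined by edges of capacity $\infty$ to the 'in' vertices of the $n=\bar n u$ original nodes; the 'in' vertex of each original or replacement node is joined to its 'out' vertex by an edge of capacity $\alpha$; the 'in' vertex of a replacement node receives edges of capacity $\infty$ from the 'out' vertices of its $l$ local helpers and one edge of capacity $\beta$ from each of its $\bar d$ helper racks, namely from a vertex to which all current nodes of that rack are joined by edges of capacity $\infty$; at each repair the nodes that are not replaced are copied by edges of capacity $\infty$; and $C$ is joined by edges of capacity $\infty$ from $k$ nodes that are present at one time. -/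

import Mathlib

namespace RackStorage

/-- The parameters of a rack-aware storage system: `nbar` racks of `u` nodes each, every node
stores `α` symbols, any `k` nodes can retrieve the file, and a failed node is repaired from `l`
surviving nodes of its own (host) rack and from `dbar` helper racks that send `β` symbols each. -/
structure Params where
  nbar : ℕ
  u : ℕ
  k : ℕ
  dbar : ℕ
  l : ℕ
  α : ℕ
  β : ℕ

/-- `⌊k / u⌋`. -/
def Params.kbar (P : Params) : ℕ := P.k / P.u

/-- `k - ⌊k / u⌋ u`. -/
def Params.u0 (P : Params) : ℕ := P.k - P.kbar * P.u

/-- The node `(e, g)` is the `g`-th node of rack `e`. -/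
abbrev Params.Node (P : Params) : Type := Fin P.nbar × Fin P.u

/-- A repair event: the node `(rack, pos)` fails and is replaced with the help of the `l` surviving
nodes `(rack, g)`, `g ∈ localHelpers`, and of the `dbar` racks in `helperRacks`. -/
structure Repair (P : Params) where
  rack : Fin P.nbar
  pos : Fin P.u
  localHelpers : Finset (Fin P.u)
  helperRacks : Finset (Fin P.nbar)
  pos_notMem : pos ∉ localHelpers
  card_localHelpers : localHelpers.card = P.l
  rack_notMem : rack ∉ helperRacks
  card_helperRacks : helperRacks.card = P.dbar

/-- The node that fails and is replaced. -/
def Repair.node {P : Params} (r : Repair P) : P.Node := (r.rack, r.pos)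

/-! ### Storage codes -/

/-- What the nodes store, as a function of the file: the file consists of `B` symbols of the
alphabet `A`, and every node stores `α` symbols. -/
abbrev Contents (P : Params) (A : Type) (B : ℕ) : Type :=
  P.Node → (Fin B → A) → (Fin P.α → A)

/-- Any `k` nodes can retrieve the file. -/
def Retrievable {P : Params} {A : Type} {B : ℕ} (s : Contents P A B) : Prop :=
  ∀ K : Finset P.Node, K.card = P.k →
    ∃ dec : (K → Fin P.α → A) → (Fin B → A), ∀ m, dec (fun v => s v m) = m

/-- The contents `s'` can arise from the contents `s` by the repair `r`: every helper rack uploads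
`β` symbols, computed from the data of all its nodes; the replacement node stores `α` symbols
computed from these and from the data of the local helpers; the other nodes are unchanged. -/
def RepairStep {P : Params} {A : Type} {B : ℕ}
    (s : Contents P A B) (r : Repair P) (s' : Contents P A B) : Prop :=
  (∀ v, v ≠ r.node → s' v = s v) ∧
  ∃ (upload : r.helperRacks → (Fin P.u → Fin P.α → A) → (Fin P.β → A))
    (gen : (r.localHelpers → Fin P.α → A) → (r.helperRacks → Fin P.β → A) → (Fin P.α → A)),
    ∀ m, s' r.node m =
      gen (fun g => s (r.rack, g) m) (fun h => upload h (fun g => s (h, g) m))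

/-- Files of `B` symbols can be stored against every finite sequence of repairs that is known in
advance: over some finite alphabet there are initial contents and coding functions for the
successive repairs such that at every time any `k` nodes can retrieve the file. That is, `B`
symbols can be multicast to all data collectors of every information flow graph. -/
def AttainableOffline (P : Params) (B : ℕ) : Prop :=
  ∀ (T : ℕ) (r : Fin T → Repair P),
    ∃ (A : Type) (_ : Finite A) (_ : Nontrivial A) (s : Fin (T + 1) → Contents P A B),
      (∀ t, Retrievable (s t)) ∧ ∀ t : Fin T, RepairStep (s t.castSucc) (r t) (s t.succ)

/-- Files of `B` symbols can be stored forever, against repairs that are not known in advance, over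
one finite alphabet: there is a nonempty family `S` of contents from each of which any `k` nodes can
retrieve the file, and in which every repair can be answered by contents in `S` again. -/
def AttainableOnline (P : Params) (B : ℕ) : Prop :=
  ∃ (A : Type) (_ : Finite A) (_ : Nontrivial A) (S : Set (Contents P A B)),
    S.Nonempty ∧ (∀ s ∈ S, Retrievable s) ∧
      ∀ s ∈ S, ∀ r : Repair P, ∃ s' ∈ S, RepairStep s r s'

/-! ### Information flow graphs -/

/-- The vertices of the information flow graph of a history of `T` repairs. -/
inductive Vertex (P : Params) (T : ℕ) : Type
  /-- the source `S` of the file -/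
  | source
  /-- the 'in' vertex of an original node -/
  | origIn (v : P.Node)
  /-- the 'in' vertex of the node that is placed by the `t`-th repair -/
  | newIn (t : Fin T)
  /-- the 'out' vertex of node `v` after the first `t` repairs -/
  | out (t : Fin (T + 1)) (v : P.Node)
  /-- the vertex of helper rack `h` at which its upload to the `t`-th repair is computed -/
  | gate (t : Fin T) (h : Fin P.nbar)
  /-- the data collector that connects to the nodes in `K` after the first `t` repairs -/
  | collector (t : Fin (T + 1)) (K : Finset P.Node)
  deriving DecidableEq, Fintype

open Classical in
/-- The capacities of the edges of the information flow graph (`0` where there is no edge). -/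
noncomputable def capacity {P : Params} {T : ℕ} (r : Fin T → Repair P) :
    Vertex P T → Vertex P T → ℕ∞
  -- the file flows to the original nodes, which store `α` symbols each
  | .source, .origIn _ => ⊤
  | .origIn v, .out t w => if t = 0 ∧ w = v then (P.α : ℕ∞) else 0
  -- a replacement node reads the local helpers, and `β` symbols from each helper rack
  | .out t w, .newIn t' =>
      if t = t'.castSucc ∧ w.1 = (r t').rack ∧ w.2 ∈ (r t').localHelpers then ⊤ else 0
  | .out t w, .gate t' h =>
      if t = t'.castSucc ∧ h ∈ (r t').helperRacks ∧ w.1 = h then ⊤ else 0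
  | .gate t h, .newIn t' => if t = t' ∧ h ∈ (r t').helperRacks then (P.β : ℕ∞) else 0
  -- a replacement node stores `α` symbols
  | .newIn t, .out t' w => if t' = t.succ ∧ w = (r t).node then (P.α : ℕ∞) else 0
  -- the nodes that are not replaced are copied
  | .out t w, .out t' w' =>
      if ∃ i : Fin T, t = i.castSucc ∧ t' = i.succ ∧ w' = w ∧ w ≠ (r i).node then ⊤ else 0
  -- a data collector reads the nodes that it connects to
  | .out t w, .collector t' K => if t = t' ∧ w ∈ K then ⊤ else 0
  | _, _ => 0

/-- The minimum capacity of a cut that separates `y` from `x` in a finite network. -/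
noncomputable def minCut {V : Type} [Fintype V] [DecidableEq V] (cap : V → V → ℕ∞) (x y : V) :
    ℕ∞ :=
  ⨅ (W : Finset V) (_ : x ∈ W ∧ y ∉ W), ∑ a ∈ W, ∑ b ∈ Wᶜ, cap a b

/-- The min-cuts between the source and the data collectors that connect to `k` nodes, over all
information flow graphs. -/
noncomputable def minCuts (P : Params) : Set ℕ∞ :=
  {c | ∃ (T : ℕ) (r : Fin T → Repair P) (t : Fin (T + 1)) (K : Finset P.Node), K.card = P.k ∧
    c = minCut (capacity r) Vertex.source (Vertex.collector t K)}

end RackStorage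

/-!
For achievability, use linear codes over a large field with the invariant that every set `A` of
nodes holds at least `potential A` independent symbols, or the whole file. Initial and replacement
symbols in general position maintain the invariant: once `A` contains `l` nodes of a rack and all
nodes of `j` helper racks, a further node of that rack raises the potential by at most
`min ((dbar - j) * β) α`, and the uploads of the other helper racks provide as much.

Conversely, for any cut whose edges all have finite capacity, the symbols sent along its edges
determine what is stored beyond the cut, so a retrievable file is no larger than the cut. A minimum
cut arises when the first `k` nodes, except for the first `l` of each rack, are repaired rack by
rack with the help of the racks that have already been repaired.
-/

namespace RackStorage

/-! ### Generic linear codes -/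

section SymbolSpan

variable (F : Type*) {E ν κ ι : Type*} [Field F] [AddCommGroup E] [Module F E]

/-- The coefficient vectors of the symbols held by the members of `A` span this space: in a linear
code over `F` these are the symbols that `A` can compute. -/
def symbolSpan (φ : ν → ι → E) (A : Finset ν) : Submodule F E :=
  A.sup fun v => Submodule.span F (Set.range (φ v))

variable {F}

theorem symbolSpan_union [DecidableEq ν] (φ : ν → ι → E) (A A' : Finset ν) :
    symbolSpan F φ (A ∪ A') = symbolSpan F φ A ⊔ symbolSpan F φ A' :=
  Finset.sup_union

theorem symbolSpan_update_of_notMem [DecidableEq ν] (φ : ν → ι → E) (ψ : ι → E) {v : ν}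
    {A : Finset ν} (hv : v ∉ A) :
    symbolSpan F (Function.update φ v ψ) A = symbolSpan F φ A :=
  Finset.sup_congr rfl fun w hw => by rw [Function.update_of_ne (ne_of_mem_of_not_mem hw hv)]

theorem symbolSpan_update_insert [DecidableEq ν] (φ : ν → ι → E) (ψ : ι → E) {v : ν}
    {A : Finset ν} (hv : v ∉ A) :
    symbolSpan F (Function.update φ v ψ) (insert v A) =
      symbolSpan F φ A ⊔ Submodule.span F (Set.range ψ) := by
  rw [← symbolSpan_update_of_notMem φ ψ hv, sup_comm, symbolSpan, Finset.sup_insert,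
    Function.update_self, symbolSpan]

end SymbolSpan

section Generic

variable {F E : Type*} [Field F] [AddCommGroup E] [Module F E]

theorem exists_mem_forall_mem_imp_le {ι : Type*} [Fintype ι]
    (hF : (Fintype.card ι : ℕ∞) < ENat.card F) (V : Submodule F E) (W : ι → Submodule F E) :
    ∃ x ∈ V, ∀ i, x ∈ W i → V ≤ W i := by
  classical
  have hproper : ∀ i : {i // ¬ V ≤ W i}, (W i).comap V.subtype ≠ ⊤ := fun i => by
    rw [Ne, Submodule.comap_subtype_eq_top]
    exact i.2
  have hcard : ((Finset.univ : Finset {i // ¬ V ≤ W i}).card : ℕ∞) < ENat.card F :=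
    (Nat.cast_le.2 (Fintype.card_subtype_le _)).trans_lt hF
  obtain ⟨-, x, -, hx⟩ := Set.ssubset_iff_exists.1
    (Submodule.iUnion_ssubset_of_forall_ne_top_of_card_lt _ _ hproper hcard)
  refine ⟨x, x.2, fun i hi => by_contra fun hVi => hx ?_⟩
  exact Set.mem_biUnion (Finset.mem_univ (⟨i, hVi⟩ : {i // ¬ V ≤ W i})) hi

variable [FiniteDimensional F E]

theorem exists_generic_family {ι : Type*} [Fintype ι] (hF : (Fintype.card ι : ℕ∞) < ENat.card F)
    (V : Submodule F E) (W : ι → Submodule F E) (b : ℕ) :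
    ∃ x : Fin b → E, (∀ j, x j ∈ V) ∧ ∀ i,
      min (Module.finrank F (W i) + b) (Module.finrank F ↥(W i ⊔ V)) ≤
        Module.finrank F ↥(W i ⊔ Submodule.span F (Set.range x)) := by
  induction b with
  | zero => exact ⟨Fin.elim0, fun j => j.elim0, fun i =>
      min_le_of_left_le (Submodule.finrank_mono le_sup_left)⟩
  | succ b ih =>
    obtain ⟨x, hxV, hx⟩ := ih
    obtain ⟨y, hyV, hy⟩ := exists_mem_forall_mem_imp_le hF V
      fun i => W i ⊔ Submodule.span F (Set.range x)
    refine ⟨Fin.cons y x, Fin.cases hyV hxV, fun i => ?_⟩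
    have hspan : W i ⊔ Submodule.span F (Set.range (Fin.cons y x : Fin (b + 1) → E)) =
        (W i ⊔ Submodule.span F (Set.range x)) ⊔ Submodule.span F {y} := by
      rw [Fin.range_cons, Submodule.span_insert, sup_comm (Submodule.span F {y}), sup_assoc]
    rw [hspan]
    by_cases hyi : y ∈ W i ⊔ Submodule.span F (Set.range x)
    · exact min_le_of_right_le (Submodule.finrank_mono
        (sup_le (le_sup_left.trans le_sup_left) ((hy i hyi).trans le_sup_left)))
    · have hlt : W i ⊔ Submodule.span F (Set.range x) <
          (W i ⊔ Submodule.span F (Set.range x)) ⊔ Submodule.span F {y} :=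
        left_lt_sup.2 fun h => hyi (h (Submodule.mem_span_singleton_self y))
      have := Submodule.finrank_lt_finrank_of_lt hlt
      have := hx i
      omega

variable {ν κ ι : Type*} [Fintype ν] [DecidableEq ν]

theorem exists_generic_update (hF : (Fintype.card (Finset ν) : ℕ∞) < ENat.card F) {a : ℕ}
    (φ : ν → Fin a → E) (v : ν) (V : Submodule F E) :
    ∃ ψ : Fin a → E, (∀ j, ψ j ∈ V) ∧ ∀ A, v ∉ A →
      min (Module.finrank F (symbolSpan F φ A) + a) (Module.finrank F ↥(symbolSpan F φ A ⊔ V)) ≤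
        Module.finrank F (symbolSpan F (Function.update φ v ψ) (insert v A)) := by
  obtain ⟨ψ, hψV, hψ⟩ := exists_generic_family hF V (symbolSpan F φ) a
  exact ⟨ψ, hψV, fun A hv => by rw [symbolSpan_update_insert φ ψ hv]; exact hψ A⟩

/-- For every `A` the helpers split into those that act as if they sent all their symbols (`H'`),
and those whose `b` symbols are all new. -/
theorem exists_generic_uploads
    (hF : (Fintype.card (Finset ν) : ℕ∞) < ENat.card F) (φ : ν → ι → E) (R : κ → Finset ν) (b : ℕ)
    (H : Finset κ) :
    ∃ x : κ → Fin b → E, (∀ h ∈ H, ∀ j, x h j ∈ symbolSpan F φ (R h)) ∧ ∀ A, ∃ H' ⊆ H,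
      Module.finrank F (symbolSpan F φ (A ∪ H'.biUnion R)) + (H.card - H'.card) * b ≤
        Module.finrank F ↥(symbolSpan F φ A ⊔ symbolSpan F x H) := by
  classical
  induction H using Finset.induction_on with
  | empty =>
    refine ⟨fun _ _ => 0, by simp, fun A => ⟨∅, subset_rfl, ?_⟩⟩
    rw [Finset.biUnion_empty, Finset.union_empty, Finset.card_empty, Nat.zero_sub, zero_mul,
      add_zero]
    exact Submodule.finrank_mono le_sup_left
  | insert h H hh ih =>
    obtain ⟨x, hxR, hx⟩ := ih
    obtain ⟨y, hyR, hy⟩ := exists_generic_family hF (symbolSpan F φ (R h))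
      (fun A => symbolSpan F φ A ⊔ symbolSpan F x H) b
    refine ⟨Function.update x h y, fun i hi j => ?_, fun A => ?_⟩
    · rcases eq_or_ne i h with rfl | hih
      · simpa using hyR j
      · simpa [hih] using hxR i (Finset.mem_of_mem_insert_of_ne hi hih) j
    rw [symbolSpan_update_insert x y hh, ← sup_assoc, Finset.card_insert_of_notMem hh]
    rcases min_le_iff.1 (hy A) with hnew | hall
    · obtain ⟨H', hH', hle⟩ := hx A
      refine ⟨H', hH'.trans (Finset.subset_insert _ _), le_trans ?_ hnew⟩
      rw [Nat.succ_sub (Finset.card_le_card hH'), Nat.succ_mul]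
      omega
    · obtain ⟨H', hH', hle⟩ := hx (A ∪ R h)
      refine ⟨insert h H', Finset.insert_subset_insert h hH', le_trans ?_ hall⟩
      rwa [Finset.card_insert_of_notMem (fun hm => hh (hH' hm)), Nat.add_sub_add_right,
        Finset.biUnion_insert, ← Finset.union_assoc, sup_right_comm, ← symbolSpan_union]

end Generic

section Robust

variable {F E ν κ : Type*} [Field F] [AddCommGroup E] [Module F E]

variable (F) in
/-- A linear code is robust with respect to a potential `p` if the members of every `A` hold at
least `p A` independent symbols, or the whole file. Suitable potentials are kept by repairs. -/
def IsRobust {ι : Type*} (p : Finset ν → ℕ) (φ : ν → ι → E) : Prop :=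
  ∀ A, min (Module.finrank F E) (p A) ≤ Module.finrank F (symbolSpan F φ A)

variable [FiniteDimensional F E]

theorem IsRobust.symbolSpan_eq_top {ι : Type*} {p : Finset ν → ℕ} {φ : ν → ι → E}
    (hφ : IsRobust F p φ) {A : Finset ν} (hA : Module.finrank F E ≤ p A) :
    symbolSpan F φ A = ⊤ :=
  Submodule.eq_top_of_finrank_eq
    ((Submodule.finrank_le _).antisymm ((le_min le_rfl hA).trans (hφ A)))

variable [Fintype ν] [DecidableEq ν] {p : Finset ν → ℕ} {a : ℕ}

theorem exists_isRobust (hF : (Fintype.card (Finset ν) : ℕ∞) < ENat.card F) (hp0 : p ∅ = 0)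
    (hp : ∀ A v, p (insert v A) ≤ p A + a) : ∃ φ : ν → Fin a → E, IsRobust F p φ := by
  suffices h : ∀ S : Finset ν, ∃ φ : ν → Fin a → E, ∀ A ⊆ S,
      min (Module.finrank F E) (p A) ≤ Module.finrank F (symbolSpan F φ A) by
    obtain ⟨φ, hφ⟩ := h Finset.univ
    exact ⟨φ, fun A => hφ A (Finset.subset_univ A)⟩
  intro S
  induction S using Finset.induction_on with
  | empty => exact ⟨fun _ _ => 0, fun A hA => by simp [Finset.subset_empty.1 hA, hp0]⟩
  | insert v S _ ih =>
    obtain ⟨φ, hφ⟩ := ih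
    obtain ⟨ψ, -, hψ⟩ := exists_generic_update hF φ v ⊤
    refine ⟨Function.update φ v ψ, fun A hA => ?_⟩
    by_cases hvA : v ∈ A
    · have hgain := hψ _ (Finset.notMem_erase v A)
      have hold := hφ _ (Finset.subset_insert_iff.1 hA)
      have hstep := hp (A.erase v) v
      rw [Finset.insert_erase hvA] at hgain hstep
      rw [sup_top_eq, finrank_top] at hgain
      omega
    · rw [symbolSpan_update_of_notMem φ ψ hvA]
      exact hφ A ((Finset.subset_insert_iff_of_notMem hvA).1 hA)

/-- If the symbols of the replacement are not all new to `A`, then `A` can compute whatever they can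
be computed from, and gains as much as from the helpers themselves. -/
theorem IsRobust.exists_repair
    (hF : (Fintype.card (Finset ν) : ℕ∞) < ENat.card F) {φ : ν → Fin a → E} (hφ : IsRobust F p φ)
    (hmono : Monotone p) {v : ν} (hp : ∀ A, p (insert v A) ≤ p A + a)
    (L : Finset ν) (R : κ → Finset ν) (H : Finset κ) (b : ℕ)
    (hpH : ∀ A, L ⊆ A → ∀ H' ⊆ H, H'.biUnion R ⊆ A →
      p (insert v A) ≤ p A + (H.card - H'.card) * b) :
    ∃ (x : κ → Fin b → E) (ψ : Fin a → E),
      (∀ h ∈ H, ∀ j, x h j ∈ symbolSpan F φ (R h)) ∧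
      (∀ j, ψ j ∈ symbolSpan F φ L ⊔ symbolSpan F x H) ∧
      IsRobust F p (Function.update φ v ψ) := by
  obtain ⟨x, hxR, hx⟩ := exists_generic_uploads hF φ R b H
  obtain ⟨ψ, hψV, hψ⟩ := exists_generic_update hF φ v (symbolSpan F φ L ⊔ symbolSpan F x H)
  refine ⟨x, ψ, hxR, hψV, fun A => ?_⟩
  by_cases hvA : v ∈ A
  swap
  · rw [symbolSpan_update_of_notMem φ ψ hvA]
    exact hφ A
  have hgain := hψ _ (Finset.notMem_erase v A)
  rw [Finset.insert_erase hvA] at hgain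
  rcases min_le_iff.1 hgain with hnew | hall
  · have hold := hφ (A.erase v)
    have hstep := hp (A.erase v)
    rw [Finset.insert_erase hvA] at hstep
    omega
  · obtain ⟨H', hH', hle⟩ := hx (A.erase v ∪ L)
    rw [symbolSpan_union φ (A.erase v) L, sup_assoc] at hle
    have hold := hφ (A.erase v ∪ L ∪ H'.biUnion R)
    have hstep := hpH _ (Finset.subset_union_right.trans Finset.subset_union_left) H' hH'
      (Finset.subset_union_right (s₁ := A.erase v ∪ L))
    have hA : p A ≤ p (insert v (A.erase v ∪ L ∪ H'.biUnion R)) :=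
      hmono (Finset.subset_insert_iff.2
        (Finset.subset_union_left.trans Finset.subset_union_left))
    omega

end Robust

/-! ### The potential of a set of nodes -/

section Potential

/-- The number of blocks with more than `l` elements decides: more than `q` such blocks already
contribute `(q + 1) l`, and at most `q` such blocks lose at most `q (u - l)`. -/
theorem mul_add_min_le_sum_min {ι : Type*} (s : Finset ι) (a : ι → ℕ) {u l : ℕ} (hl : l ≤ u)
    (ha : ∀ i ∈ s, a i ≤ u) {q r : ℕ} (h : q * u + r ≤ ∑ i ∈ s, a i) :
    q * l + min r l ≤ ∑ i ∈ s, min (a i) l := by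
  obtain ⟨c, rfl⟩ := Nat.exists_eq_add_of_le hl
  rcases lt_or_ge q (s.filter fun i => l < a i).card with hq | hq
  · calc q * l + min r l ≤ (q + 1) * l := by rw [Nat.succ_mul]; omega
      _ ≤ (s.filter fun i => l < a i).card * l := Nat.mul_le_mul_right l hq
      _ ≤ ∑ i ∈ s with l < a i, min (a i) l := Finset.card_nsmul_le_sum _ _ _ fun i hi =>
          le_min (Finset.mem_filter.1 hi).2.le le_rfl
      _ ≤ ∑ i ∈ s, min (a i) l := Finset.sum_le_sum_of_subset (Finset.filter_subset _ _)
  · have hsum : ∑ i ∈ s, a i ≤ ∑ i ∈ s, min (a i) l + (s.filter fun i => l < a i).card * c := by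
      rw [Finset.card_filter, Finset.sum_mul, ← Finset.sum_add_distrib]
      refine Finset.sum_le_sum fun i hi => ?_
      have := ha i hi
      split_ifs <;> omega
    have hloss := Nat.mul_le_mul_right c hq
    rw [mul_add] at h
    omega

theorem sum_range_le_sum_range_add_mul {f : ℕ → ℕ} {a : ℕ} (hf : ∀ x, f x ≤ a) (m n : ℕ) :
    ∑ x ∈ Finset.range m, f x ≤ ∑ x ∈ Finset.range n, f x + (m - n) * a := by
  calc ∑ x ∈ Finset.range m, f x ≤ ∑ x ∈ Finset.range (n + (m - n)), f x :=
        Finset.sum_le_sum_of_subset (Finset.range_mono (by omega))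
    _ = ∑ x ∈ Finset.range n, f x + ∑ x ∈ Finset.range (m - n), f (n + x) :=
        Finset.sum_range_add f n (m - n)
    _ ≤ ∑ x ∈ Finset.range n, f x + (m - n) * a := by
        gcongr
        simpa using Finset.sum_le_card_nsmul (Finset.range (m - n)) _ a fun x _ => hf (n + x)

variable (P : Params)

/-- The number of symbols that a replacement gains for a data collector that already knows `j` of
the helper racks. -/
def Params.weight (j : ℕ) : ℕ := min ((P.dbar - j) * P.β) P.α

/-- The number of nodes at the first `l` positions of their racks, if `k` nodes fill up one rack
after the other. -/
def Params.core : ℕ := P.kbar * P.l + min P.u0 P.l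

/-- The number of the other nodes, at the last `u - l` positions. -/
def Params.excess : ℕ := P.kbar * (P.u - P.l) + (P.u0 - P.l)

/-- The maximum file size, written with one summand for each of the `P.core + P.excess = k` nodes
of a data collector. -/
def Params.maxFileSize : ℕ :=
  P.core * P.α + ∑ x ∈ Finset.range P.excess, P.weight (x / (P.u - P.l))

theorem Params.weight_le (j : ℕ) : P.weight j ≤ P.α := min_le_right _ _

theorem Params.weight_antitone : Antitone P.weight := fun _ _ h =>
  min_le_min_right _ (Nat.mul_le_mul_right _ (Nat.sub_le_sub_left h _))

theorem Params.kbar_mul_u_add_u0 : P.kbar * P.u + P.u0 = P.k :=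
  Nat.add_sub_cancel' (Nat.div_mul_le_self P.k P.u)

variable {P}

theorem Params.u0_lt_u (hl : P.l < P.u) : P.u0 < P.u := by
  have := Nat.div_add_mod' P.k P.u
  have := Nat.mod_lt P.k (Nat.zero_lt_of_lt hl)
  rw [u0, kbar]
  omega

theorem Params.core_add_excess (hl : P.l < P.u) : P.core + P.excess = P.k := by
  obtain ⟨c, hc⟩ := Nat.exists_eq_add_of_le hl.le
  have hk := P.kbar_mul_u_add_u0
  rw [hc, mul_add] at hk
  rw [core, excess, hc, Nat.add_sub_cancel_left]
  omega

/-- The number of nodes of rack `e` in `A`. -/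
def rackCount (A : Finset P.Node) (e : Fin P.nbar) : ℕ := (A.filter fun v => v.1 = e).card

theorem rackCount_mono {A A' : Finset P.Node} (h : A ⊆ A') (e : Fin P.nbar) :
    rackCount A e ≤ rackCount A' e :=
  Finset.card_le_card (Finset.filter_subset_filter _ h)

theorem card_le_rackCount {A : Finset P.Node} {e : Fin P.nbar} {L : Finset (Fin P.u)}
    (h : {e} ×ˢ L ⊆ A) : L.card ≤ rackCount A e := by
  calc L.card = (({e} : Finset (Fin P.nbar)) ×ˢ L).card := by simp
    _ ≤ rackCount A e := Finset.card_le_card fun v hv =>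
        Finset.mem_filter.2 ⟨h hv, Finset.mem_singleton.1 (Finset.mem_product.1 hv).1⟩

theorem rackCount_le (A : Finset P.Node) (e : Fin P.nbar) : rackCount A e ≤ P.u := by
  calc rackCount A e ≤ (({e} : Finset (Fin P.nbar)) ×ˢ (Finset.univ : Finset (Fin P.u))).card :=
        Finset.card_le_card fun v hv => Finset.mem_product.2
          ⟨Finset.mem_singleton.2 (Finset.mem_filter.1 hv).2, Finset.mem_univ _⟩
    _ = P.u := by simp

theorem sum_rackCount (A : Finset P.Node) : ∑ e, rackCount A e = A.card :=
  (Finset.card_eq_sum_card_fiberwise (f := Prod.fst) (t := Finset.univ) (by simp)).symm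

theorem sum_rackCount_insert (f : ℕ → ℕ) {A : Finset P.Node} {v : P.Node} (hv : v ∉ A) :
    ∑ e, f (rackCount (insert v A) e) + f (rackCount A v.1) =
      ∑ e, f (rackCount A e) + f (rackCount A v.1 + 1) := by
  have hself : rackCount (insert v A) v.1 = rackCount A v.1 + 1 := by
    rw [rackCount, Finset.filter_insert, if_pos rfl, Finset.card_insert_of_notMem (by simp [hv]),
      rackCount]
  have hother : ∀ e ∈ Finset.univ.erase v.1, f (rackCount (insert v A) e) = f (rackCount A e) :=
    fun e he => by
      rw [rackCount, Finset.filter_insert, if_neg (Finset.ne_of_mem_erase he).symm, rackCount]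
  rw [← Finset.add_sum_erase _ _ (Finset.mem_univ v.1), Finset.sum_congr rfl hother, hself,
    ← Finset.add_sum_erase _ (fun e => f (rackCount A e)) (Finset.mem_univ v.1)]
  ring

/-- The number of nodes of `A`, where at most `l` are counted in each rack. -/
def coreCount (A : Finset P.Node) : ℕ := ∑ e, min (rackCount A e) P.l

/-- The number of nodes of `A` beyond the first `l` of each rack. -/
def excessCount (A : Finset P.Node) : ℕ := ∑ e, (rackCount A e - P.l)

theorem coreCount_add_excessCount (A : Finset P.Node) :
    coreCount A + excessCount A = A.card := by
  rw [coreCount, excessCount, ← Finset.sum_add_distrib, ← sum_rackCount]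
  exact Finset.sum_congr rfl fun e _ => by omega

theorem core_le_coreCount (hl : P.l < P.u) {A : Finset P.Node} (hA : P.k ≤ A.card) :
    P.core ≤ coreCount A :=
  mul_add_min_le_sum_min Finset.univ (rackCount A) hl.le (fun e _ => rackCount_le A e) <| by
    rwa [sum_rackCount, P.kbar_mul_u_add_u0]

theorem mul_le_excessCount {A : Finset P.Node} {H : Finset (Fin P.nbar)}
    (h : ∀ e ∈ H, {e} ×ˢ Finset.univ ⊆ A) : H.card * (P.u - P.l) ≤ excessCount A := by
  calc H.card * (P.u - P.l) ≤ ∑ e ∈ H, (rackCount A e - P.l) :=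
        Finset.card_nsmul_le_sum _ _ _ fun e he =>
          Nat.sub_le_sub_right (by simpa using card_le_rackCount (h e he)) _
    _ ≤ excessCount A := Finset.sum_le_sum_of_subset (Finset.subset_univ H)

/-- The least number of independent symbols that the nodes of `A` hold in the code to be
constructed: `α` for each of the first `l` nodes of a rack, and for the further nodes the weights
that they have if they fill up one rack after the other, with `u - l` of them in a rack. -/
def potential (A : Finset P.Node) : ℕ :=
  coreCount A * P.α + ∑ x ∈ Finset.range (excessCount A), P.weight (x / (P.u - P.l))

theorem potential_empty : potential (∅ : Finset P.Node) = 0 := by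
  simp [potential, coreCount, excessCount, rackCount]

theorem potential_mono : Monotone (potential (P := P)) := fun A A' h => by
  have hcore : coreCount A ≤ coreCount A' :=
    Finset.sum_le_sum fun e _ => min_le_min_right _ (rackCount_mono h e)
  have hexcess : excessCount A ≤ excessCount A' :=
    Finset.sum_le_sum fun e _ => Nat.sub_le_sub_right (rackCount_mono h e) _
  exact Nat.add_le_add (Nat.mul_le_mul_right _ hcore)
    (Finset.sum_le_sum_of_subset (Finset.range_mono hexcess))

theorem maxFileSize_le_potential (hl : P.l < P.u) {A : Finset P.Node} (hA : P.k ≤ A.card) :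
    P.maxFileSize ≤ potential A := by
  have hcore := core_le_coreCount hl hA
  have hcount : P.excess - excessCount A ≤ coreCount A - P.core := by
    have := coreCount_add_excessCount A
    have := P.core_add_excess hl
    omega
  calc P.maxFileSize
      ≤ P.core * P.α + (∑ x ∈ Finset.range (excessCount A), P.weight (x / (P.u - P.l)) +
          (P.excess - excessCount A) * P.α) :=
        Nat.add_le_add_left (sum_range_le_sum_range_add_mul (fun x => P.weight_le _) _ _) _
    _ ≤ P.core * P.α + (∑ x ∈ Finset.range (excessCount A), P.weight (x / (P.u - P.l)) +
          (coreCount A - P.core) * P.α) := by gcongr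
    _ = (P.core + (coreCount A - P.core)) * P.α +
          ∑ x ∈ Finset.range (excessCount A), P.weight (x / (P.u - P.l)) := by ring
    _ = potential A := by rw [Nat.add_sub_cancel' hcore, potential]

theorem potential_insert_of_lt {A : Finset P.Node} {v : P.Node} (hv : v ∉ A)
    (h : rackCount A v.1 < P.l) : potential (insert v A) = potential A + P.α := by
  have hcore : coreCount (insert v A) = coreCount A + 1 := by
    have := sum_rackCount_insert (min · P.l) hv
    simp only [coreCount]
    omega
  have hexcess : excessCount (insert v A) = excessCount A := by
    have := sum_rackCount_insert (· - P.l) hv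
    simp only [excessCount]
    omega
  rw [potential, hcore, hexcess, potential]
  ring

theorem potential_insert_of_le {A : Finset P.Node} {v : P.Node} (hv : v ∉ A)
    (h : P.l ≤ rackCount A v.1) :
    potential (insert v A) = potential A + P.weight (excessCount A / (P.u - P.l)) := by
  have hcore : coreCount (insert v A) = coreCount A := by
    have := sum_rackCount_insert (min · P.l) hv
    simp only [coreCount]
    omega
  have hexcess : excessCount (insert v A) = excessCount A + 1 := by
    have := sum_rackCount_insert (· - P.l) hv
    simp only [excessCount]
    omega
  rw [potential, hcore, hexcess, Finset.sum_range_succ, potential, add_assoc]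

theorem potential_insert_le (A : Finset P.Node) (v : P.Node) :
    potential (insert v A) ≤ potential A + P.α := by
  by_cases hv : v ∈ A
  · rw [Finset.insert_eq_of_mem hv]
    exact Nat.le_add_right _ _
  rcases lt_or_ge (rackCount A v.1) P.l with h | h
  · exact (potential_insert_of_lt hv h).le
  · rw [potential_insert_of_le hv h]
    exact Nat.add_le_add_left (P.weight_le _) _

/-- Every full rack contributes `u - l` to `excessCount A`, so that the summand that `v` adds to the
potential has an index of at least `H.card`. -/
theorem potential_insert_le_of_subset (hl : P.l < P.u) {A : Finset P.Node} {v : P.Node}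
    (h : P.l ≤ rackCount A v.1) {H : Finset (Fin P.nbar)}
    (hH : ∀ e ∈ H, {e} ×ˢ Finset.univ ⊆ A) :
    potential (insert v A) ≤ potential A + P.weight H.card := by
  by_cases hv : v ∈ A
  · rw [Finset.insert_eq_of_mem hv]
    exact Nat.le_add_right _ _
  rw [potential_insert_of_le hv h]
  exact Nat.add_le_add_left
    (P.weight_antitone ((Nat.le_div_iff_mul_le (Nat.sub_pos_of_lt hl)).2 (mul_le_excessCount hH))) _

end Potential

section ClosedForm

theorem sum_range_div (f : ℕ → ℕ) {c r : ℕ} (hr : r ≤ c) (q : ℕ) :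
    ∑ x ∈ Finset.range (q * c + r), f (x / c) = c * ∑ j ∈ Finset.range q, f j + r * f q := by
  have hblock (j s : ℕ) (hs : s ≤ c) : ∑ x ∈ Finset.range s, f ((j * c + x) / c) = s * f j := by
    rw [Finset.sum_congr rfl (g := fun _ => f j), Finset.sum_const, Finset.card_range, smul_eq_mul]
    intro x hx
    have hxc := (Finset.mem_range.1 hx).trans_le hs
    rw [mul_comm, Nat.mul_add_div (by omega), Nat.div_eq_of_lt hxc, add_zero]
  induction q generalizing r with
  | zero => simpa using hblock 0 r hr
  | succ q ih =>
    rw [Finset.sum_range_add, hblock _ r hr, Nat.succ_mul, ih le_rfl, Finset.sum_range_succ,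
      mul_add]

variable {P : Params}

theorem Params.maxFileSize_eq (hl : P.l < P.u) :
    P.maxFileSize = (P.kbar * P.l + min P.u0 P.l) * P.α +
      (P.u - P.l) * ∑ j ∈ Finset.range P.kbar, min ((P.dbar - j) * P.β) P.α +
      (P.u0 - P.l) * min ((P.dbar - P.kbar) * P.β) P.α := by
  rw [maxFileSize, excess, sum_range_div _ (Nat.sub_le_sub_right (P.u0_lt_u hl).le _), ← add_assoc]
  rfl

theorem sum_range_min_sub_mul {d n : ℕ} (h : d ≤ n) (a b : ℕ) :
    ∑ j ∈ Finset.range n, min ((d - j) * b) a = ∑ i ∈ Finset.Icc 1 d, min (i * b) a := by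
  obtain ⟨m, rfl⟩ := Nat.exists_eq_add_of_le h
  have hzero : ∑ j ∈ Finset.range m, min ((d - (d + j)) * b) a = 0 := by simp
  rw [Finset.sum_range_add, hzero, add_zero, Finset.range_eq_Ico,
    Finset.sum_Ico_reflect (fun i => min (i * b) a) 0 (Nat.le_succ d)]
  rw [Nat.add_sub_cancel_left, Nat.sub_zero, Finset.Ico_add_one_right_eq_Icc]

end ClosedForm

section LinearCode

theorem symbolSpan_le_eqLocus_eval_iff {F M ν ι : Type*} [Field F] [AddCommGroup M] [Module F M]
    {φ : ν → ι → Module.Dual F M} {A : Finset ν} {m m' : M} :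
    symbolSpan F φ A ≤ LinearMap.eqLocus (Module.Dual.eval F M m) (Module.Dual.eval F M m') ↔
      ∀ v ∈ A, ∀ j, φ v j m = φ v j m' := by
  simp [symbolSpan, Submodule.span_le, Set.range_subset_iff]

variable {P : Params} {F : Type} [Field F] {B : ℕ}

/-- The contents given by a linear code: each symbol of a node is a linear functional of the
file. -/
def linearContents (φ : P.Node → Fin P.α → Module.Dual F (Fin B → F)) : Contents P F B :=
  fun v m j => φ v j m

theorem retrievable_linearContents {φ : P.Node → Fin P.α → Module.Dual F (Fin B → F)}
    (hφ : ∀ K : Finset P.Node, K.card = P.k → symbolSpan F φ K = ⊤) :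
    Retrievable (linearContents φ) := by
  intro K hK
  have hinj : Function.Injective fun m (v : K) => linearContents φ v m := fun m m' h => by
    rw [← sub_eq_zero, ← Module.forall_dual_apply_eq_zero_iff F]
    intro x
    have hle := symbolSpan_le_eqLocus_eval_iff.2 fun v (hv : v ∈ K) j => congrFun₂ h ⟨v, hv⟩ j
    rw [hφ K hK] at hle
    rw [map_sub, sub_eq_zero]
    exact hle (Submodule.mem_top (x := x))
  exact ⟨Function.invFun _, Function.leftInverse_invFun hinj⟩

theorem repairStep_linearContents {φ : P.Node → Fin P.α → Module.Dual F (Fin B → F)} {r : Repair P}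
    {x : Fin P.nbar → Fin P.β → Module.Dual F (Fin B → F)}
    {ψ : Fin P.α → Module.Dual F (Fin B → F)}
    (hx : ∀ h ∈ r.helperRacks, ∀ j, x h j ∈ symbolSpan F φ ({h} ×ˢ Finset.univ))
    (hψ : ∀ j, ψ j ∈ symbolSpan F φ ({r.rack} ×ˢ r.localHelpers) ⊔ symbolSpan F x r.helperRacks) :
    RepairStep (linearContents φ) r (linearContents (Function.update φ r.node ψ)) := by
  have hrack {e : Fin P.nbar} {L : Finset (Fin P.u)} {m m' : Fin B → F}
      (hm : ∀ g ∈ L, linearContents φ (e, g) m = linearContents φ (e, g) m') :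
      symbolSpan F φ ({e} ×ˢ L) ≤
        LinearMap.eqLocus (Module.Dual.eval F _ m) (Module.Dual.eval F _ m') := by
    refine symbolSpan_le_eqLocus_eval_iff.2 fun ⟨e', g⟩ hv j => ?_
    obtain ⟨he, hg⟩ := Finset.mem_product.1 hv
    obtain rfl : e' = e := Finset.mem_singleton.1 he
    exact congrFun (hm g hg) j
  have hupload (h : r.helperRacks) : Function.FactorsThrough (fun m j => x h j m)
      fun m g => linearContents φ (h, g) m := fun m m' hm =>
    funext fun j => hrack (fun g _ => congrFun hm g) (hx h h.2 j)
  have hgen : Function.FactorsThrough (fun m j => ψ j m) fun m =>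
      ((fun g : r.localHelpers => linearContents φ (r.rack, g) m),
        (fun (h : r.helperRacks) j => x h j m)) := fun m m' hm => by
    obtain ⟨hlocal, hhelp⟩ := Prod.mk.inj hm
    have hle := symbolSpan_le_eqLocus_eval_iff.2 fun h (hh : h ∈ r.helperRacks) j =>
      congrFun₂ hhelp ⟨h, hh⟩ j
    exact funext fun j => sup_le (hrack fun g hg => congrFun hlocal ⟨g, hg⟩) hle (hψ j)
  choose upload hupload using fun h => (Function.factorsThrough_iff _).1 (hupload h)
  obtain ⟨gen, hgen⟩ := (Function.factorsThrough_iff _).1 hgen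
  refine ⟨fun v hv => ?_, upload, fun a b => gen (a, b), fun m => ?_⟩
  · unfold linearContents
    rw [Function.update_of_ne hv]
  · calc linearContents (Function.update φ r.node ψ) r.node m = fun j => ψ j m := by
          unfold linearContents
          rw [Function.update_self]
      _ = gen (fun g => linearContents φ (r.rack, g) m, fun h j => x h j m) := congrFun hgen m
      _ = _ := congrArg (fun b => gen (_, b)) (funext fun h => congrFun (hupload h) m)

theorem attainableOnline_maxFileSize (hl : P.l < P.u) : AttainableOnline P P.maxFileSize := by
  obtain ⟨q, hq, hprime⟩ := Nat.exists_infinite_primes (Fintype.card (Finset P.Node) + 1)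
  have : Fact q.Prime := ⟨hprime⟩
  have hF : (Fintype.card (Finset P.Node) : ℕ∞) < ENat.card (ZMod q) := by
    rw [ENat.card_eq_coe_fintype_card, ZMod.card]
    exact_mod_cast hq
  have hE : Module.finrank (ZMod q) (Module.Dual (ZMod q) (Fin P.maxFileSize → ZMod q)) =
      P.maxFileSize := by
    rw [Subspace.dual_finrank_eq, Module.finrank_fin_fun]
  refine ⟨ZMod q, inferInstance, inferInstance,
    {s | ∃ φ, IsRobust (ZMod q) potential φ ∧ s = linearContents φ}, ?_, ?_, ?_⟩
  · obtain ⟨φ, hφ⟩ := exists_isRobust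
      (E := Module.Dual (ZMod q) (Fin P.maxFileSize → ZMod q)) hF potential_empty
      potential_insert_le
    exact ⟨_, φ, hφ, rfl⟩
  · rintro _ ⟨φ, hφ, rfl⟩
    exact retrievable_linearContents fun K hK => hφ.symbolSpan_eq_top <|
      hE.trans_le (maxFileSize_le_potential hl hK.ge)
  · rintro _ ⟨φ, hφ, rfl⟩ r
    obtain ⟨x, ψ, hx, hψ, hφ'⟩ := hφ.exists_repair hF potential_mono
      (potential_insert_le · r.node) ({r.rack} ×ˢ r.localHelpers) (fun h => {h} ×ˢ Finset.univ)
      r.helperRacks P.β fun A hL H' _ hH' => by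
        have hlocal : P.l ≤ rackCount A r.rack :=
          r.card_localHelpers.ge.trans (card_le_rackCount hL)
        rw [r.card_helperRacks]
        exact (potential_insert_le_of_subset hl hlocal (Finset.biUnion_subset.1 hH')).trans
          (Nat.add_le_add_left (min_le_left _ _) _)
    exact ⟨_, ⟨_, hφ', rfl⟩, repairStep_linearContents hx hψ⟩

end LinearCode

theorem AttainableOnline.offline {P : Params} {B : ℕ} (h : AttainableOnline P B) :
    AttainableOffline P B := by
  obtain ⟨A, hfin, hnt, S, ⟨s0, hs0⟩, hret, hstep⟩ := h
  choose! next hnext hrep using hstep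
  intro T r
  let s (t : Fin (T + 1)) : S :=
    t.induction ⟨s0, hs0⟩ fun t s => ⟨next s (r t), hnext s s.2 (r t)⟩
  refine ⟨A, hfin, hnt, fun t => s t, fun t => hret _ (s t).2, fun t => ?_⟩
  exact hrep _ (s t.castSucc).2 (r t)

/-! ### Storage codes and cuts -/

section CutBound

variable {P : Params} {T : ℕ} (r : Fin T → Repair P)

/-- The edges of finite capacity: those that store at an original node, those that store at a
replacement node, and those that upload from a helper rack. -/
abbrev Link : Type := P.Node ⊕ Fin T ⊕ (Σ t, (r t).helperRacks)

/-- The two ends of an edge of finite capacity. -/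
def endpoints : Link r → Vertex P T × Vertex P T
  | .inl v => (.origIn v, .out 0 v)
  | .inr (.inl t) => (.newIn t, .out t.succ (r t).node)
  | .inr (.inr ⟨t, h⟩) => (.gate t h, .newIn t)

/-- The capacity of an edge of finite capacity. -/
def width : Link r → ℕ
  | .inl _ => P.α
  | .inr (.inl _) => P.α
  | .inr (.inr _) => P.β

theorem endpoints_injective : Function.Injective (endpoints r) := by
  rintro (v | t | ⟨t, h⟩) (v' | t' | ⟨t', h'⟩) heq <;>
    simp only [endpoints, Prod.mk.injEq, Vertex.origIn.injEq, Vertex.newIn.injEq,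
      Vertex.gate.injEq, reduceCtorEq, false_and] at heq
  · rw [heq.1]
  · rw [heq.1]
  · obtain ⟨⟨rfl, hh⟩, -⟩ := heq
    rw [Subtype.ext hh]

theorem capacity_endpoints (i : Link r) :
    capacity r (endpoints r i).1 (endpoints r i).2 = width r i := by
  rcases i with v | t | ⟨t, h⟩ <;> simp [endpoints, width, capacity]

theorem capacity_cases (a b : Vertex P T) :
    capacity r a b = 0 ∨ capacity r a b = ⊤ ∨ (a, b) ∈ Set.range (endpoints r) := by
  cases a <;> cases b <;> simp only [capacity, true_or, or_true] <;> split_ifs with h <;>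
    first
    | exact Or.inl rfl
    | exact Or.inr (Or.inl rfl)
    | refine Or.inr (Or.inr ?_)
  · obtain ⟨rfl, rfl⟩ := h
    exact ⟨.inl _, rfl⟩
  · obtain ⟨rfl, rfl⟩ := h
    exact ⟨.inr (.inl _), rfl⟩
  · obtain ⟨rfl, h⟩ := h
    exact ⟨.inr (.inr ⟨_, _, h⟩), rfl⟩

variable (W : Finset (Vertex P T))

/-- The edges of finite capacity that leave `W`. -/
def cutLinks : Finset (Link r) := Finset.univ.filter fun i => endpoints r i ∈ W ×ˢ Wᶜ

variable {r W}

theorem mem_cutLinks {i : Link r} :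
    i ∈ cutLinks r W ↔ (endpoints r i).1 ∈ W ∧ (endpoints r i).2 ∉ W := by
  simp [cutLinks]

theorem sum_capacity_eq (hW : ∀ a ∈ W, ∀ b ∉ W, capacity r a b ≠ ⊤) :
    ∑ a ∈ W, ∑ b ∈ Wᶜ, capacity r a b = (∑ i ∈ cutLinks r W, width r i : ℕ) := by
  rw [← Finset.sum_product', Nat.cast_sum]
  refine (Finset.sum_of_injOn (endpoints r) (endpoints_injective r).injOn
    (fun i hi => (Finset.mem_filter.1 hi).2) (fun p hp hnot => ?_)
    fun i _ => (capacity_endpoints r i).symm).symm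
  obtain ⟨ha, hb⟩ := Finset.mem_product.1 hp
  rcases capacity_cases r p.1 p.2 with h | h | ⟨i, hi⟩
  · exact h
  · exact absurd h (hW _ ha _ (Finset.mem_compl.1 hb))
  · refine absurd ⟨i, Finset.mem_filter.2 ⟨Finset.mem_univ i, ?_⟩, hi⟩ hnot
    rwa [hi]

variable {A : Type} {B : ℕ} (s : Fin (T + 1) → Contents P A B)
  (upload : ∀ t, (r t).helperRacks → (Fin P.u → Fin P.α → A) → (Fin P.β → A))

/-- The symbols that a storage code sends along an edge of finite capacity. -/
def linkSymbols (m : Fin B → A) : ∀ i : Link r, Fin (width r i) → A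
  | .inl v => s 0 v m
  | .inr (.inl t) => s t.succ (r t).node m
  | .inr (.inr ⟨t, h⟩) => upload t h fun g => s t.castSucc (h, g) m

variable {s upload}
  {gen : ∀ t, ((r t).localHelpers → Fin P.α → A) → ((r t).helperRacks → Fin P.β → A) →
    (Fin P.α → A)}

theorem eq_of_linkSymbols_eq (hsource : Vertex.source ∈ W)
    (hW : ∀ a ∈ W, ∀ b ∉ W, capacity r a b ≠ ⊤)
    (hkeep : ∀ t v, v ≠ (r t).node → s t.succ v = s t.castSucc v)
    (hgen : ∀ t m, s t.succ (r t).node m =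
      gen t (fun g => s t.castSucc ((r t).rack, g) m)
        (fun h => upload t h fun g => s t.castSucc (h, g) m))
    {m m' : Fin B → A}
    (hm : ∀ i ∈ cutLinks r W, linkSymbols s upload m i = linkSymbols s upload m' i)
    {t : Fin (T + 1)} {v : P.Node} (hv : Vertex.out t v ∉ W) : s t v m = s t v m' := by
  have hin {a b} (hb : b ∉ W) (h : capacity r a b = ⊤) : a ∉ W := fun ha => hW a ha b hb h
  induction t using Fin.induction generalizing v with
  | zero =>
    have horig : Vertex.origIn v ∈ W := by_contra fun hn => hin (a := .source) hn rfl hsource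
    exact hm (.inl v) (mem_cutLinks.2 ⟨horig, hv⟩)
  | succ t ih =>
    by_cases hvt : v = (r t).node
    · subst hvt
      by_cases hnew : Vertex.newIn t ∈ W
      · exact hm (.inr (.inl t)) (mem_cutLinks.2 ⟨hnew, hv⟩)
      have hlocal (g : (r t).localHelpers) :
          s t.castSucc ((r t).rack, g) m = s t.castSucc ((r t).rack, g) m' :=
        ih (hin hnew (if_pos ⟨rfl, rfl, g.2⟩))
      have hupload (h : (r t).helperRacks) : (upload t h fun g => s t.castSucc (h, g) m) =
          upload t h fun g => s t.castSucc (h, g) m' := by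
        by_cases hgate : Vertex.gate t h ∈ W
        · exact hm (.inr (.inr ⟨t, h⟩)) (mem_cutLinks.2 ⟨hgate, hnew⟩)
        · exact congrArg _ (funext fun g => ih (hin hgate (if_pos ⟨rfl, h.2, rfl⟩)))
      rw [hgen, hgen, funext hlocal, funext hupload]
    · rw [hkeep t v hvt]
      exact ih (hin hv (if_pos ⟨t, rfl, rfl, rfl, hvt⟩))

theorem le_sum_width [Finite A] [Nontrivial A] (hret : ∀ t, Retrievable (s t))
    (hstep : ∀ t : Fin T, RepairStep (s t.castSucc) (r t) (s t.succ))
    {t : Fin (T + 1)} {K : Finset P.Node} (hK : K.card = P.k) (hsource : Vertex.source ∈ W)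
    (hcoll : Vertex.collector t K ∉ W) (hW : ∀ a ∈ W, ∀ b ∉ W, capacity r a b ≠ ⊤) :
    B ≤ ∑ i ∈ cutLinks r W, width r i := by
  choose hkeep upload gen hgen using hstep
  obtain ⟨dec, hdec⟩ := hret t K hK
  have hinj : Function.Injective fun m (i : cutLinks r W) => linkSymbols s upload m i := by
    intro m m' hm
    rw [← hdec m, ← hdec m']
    refine congrArg dec (funext fun v => eq_of_linkSymbols_eq hsource hW hkeep hgen
      (fun i hi => congrFun hm ⟨i, hi⟩) fun hv => hW _ hv _ hcoll (if_pos ⟨rfl, v.2⟩))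
  have hcard := Nat.card_le_card_of_injective _ hinj
  simp only [Nat.card_pi, Finset.prod_const, Finset.card_univ, Fintype.card_fin,
    Finset.prod_pow_eq_pow_sum] at hcard
  rw [← Finset.sum_coe_sort]
  exact (Nat.pow_le_pow_iff_right Finite.one_lt_card).1 hcard

theorem AttainableOffline.le_of_mem_minCuts (h : AttainableOffline P B) {c : ℕ∞}
    (hc : c ∈ minCuts P) : (B : ℕ∞) ≤ c := by
  obtain ⟨T, r, t, K, hK, rfl⟩ := hc
  obtain ⟨A, _, _, s, hret, hstep⟩ := h T r
  refine le_iInf₂ fun W ⟨hsource, hcoll⟩ => ?_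
  by_cases hW : ∀ a ∈ W, ∀ b ∉ W, capacity r a b ≠ ⊤
  · rw [sum_capacity_eq hW]
    exact_mod_cast le_sum_width hret hstep hK hsource hcoll hW
  · push Not at hW
    obtain ⟨a, ha, b, hb, htop⟩ := hW
    calc (B : ℕ∞) ≤ ⊤ := le_top
      _ = capacity r a b := htop.symm
      _ ≤ ∑ b ∈ Wᶜ, capacity r a b :=
        Finset.single_le_sum (fun _ _ => zero_le) (Finset.mem_compl.2 hb)
      _ ≤ ∑ a ∈ W, ∑ b ∈ Wᶜ, capacity r a b :=
        Finset.single_le_sum (f := fun a => ∑ b ∈ Wᶜ, capacity r a b) (fun _ _ => zero_le) ha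

end CutBound

/-! ### The worst history of repairs -/

section WorstCase

variable {P : Params}

theorem mul_add_self_le_mul_of_lt {a b : ℕ} (h : a < b) (c : ℕ) : a * c + c ≤ b * c := by
  rw [← Nat.succ_mul]
  exact Nat.mul_le_mul_right c h

theorem div_mul_add_mod_lt (hl : P.l < P.u) {t : ℕ} (ht : t < P.excess) :
    t / (P.u - P.l) * P.u + (P.l + t % (P.u - P.l)) < P.k := by
  have hmod := Nat.mod_lt t (Nat.sub_pos_of_lt hl)
  have hu0 := P.u0_lt_u hl
  have ht' := Nat.div_add_mod' t (P.u - P.l)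
  rw [← P.kbar_mul_u_add_u0]
  rw [Params.excess] at ht
  rcases lt_trichotomy (t / (P.u - P.l)) P.kbar with h | h | h
  · have := mul_add_self_le_mul_of_lt h P.u
    omega
  · rw [h] at ht' ⊢
    omega
  · have := mul_add_self_le_mul_of_lt h (P.u - P.l)
    omega

/-- The first `k` nodes, in the order that fills up one rack after the other. -/
def firstNodes (P : Params) : Finset P.Node :=
  Finset.univ.filter fun v => v.1.val * P.u + v.2 < P.k

theorem mem_firstNodes {v : P.Node} : v ∈ firstNodes P ↔ v.1.val * P.u + v.2 < P.k := by
  simp [firstNodes]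

theorem card_firstNodes (hk : P.k ≤ P.nbar * P.u) : (firstNodes P).card = P.k := by
  calc (firstNodes P).card
      = (Finset.univ.filter fun i : Fin (P.nbar * P.u) => i.val < P.k).card := by
        refine Finset.card_equiv finProdFinEquiv fun v => ?_
        simp [firstNodes, add_comm, mul_comm]
    _ = P.k := by rw [Fin.card_filter_val_lt, min_eq_right hk]

theorem mem_firstNodes_of_lt {v w : P.Node} (hw : w ∈ firstNodes P) (h : v.1 < w.1) :
    v ∈ firstNodes P := by
  rw [mem_firstNodes] at hw ⊢
  have hrow := mul_add_self_le_mul_of_lt h P.u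
  have := v.2.2
  omega

section Order

variable (hl : P.l < P.u) (hk : P.k ≤ P.nbar * P.u)

/-- The `t`-th of the first `k` nodes that are not among the first `l` nodes of their racks. -/
def worstNode (t : Fin P.excess) : P.Node where
  fst := ⟨t / (P.u - P.l), Nat.lt_of_mul_lt_mul_right <|
    (Nat.le_add_right _ _).trans_lt ((div_mul_add_mod_lt hl t.2).trans_le hk)⟩
  snd := ⟨P.l + t % (P.u - P.l), by
    have := Nat.mod_lt t (Nat.sub_pos_of_lt hl)
    omega⟩

theorem worstNode_mem_firstNodes (t : Fin P.excess) : worstNode hl hk t ∈ firstNodes P :=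
  mem_firstNodes.2 (div_mul_add_mod_lt hl t.2)

/-- The index of a node in the order of `worstNode`; a truncated subtraction makes it meaningless
for the first `l` nodes of a rack. -/
def worstTime (v : P.Node) : ℕ := v.1 * (P.u - P.l) + (v.2 - P.l)

include hl in
theorem worstTime_lt_of_lt_div {v : P.Node} {t : ℕ} (h : v.1 < t / (P.u - P.l)) :
    worstTime v < t := by
  have hv2 := v.2.2
  have := mul_add_self_le_mul_of_lt h (P.u - P.l)
  have := Nat.div_mul_le_self t (P.u - P.l)
  rw [worstTime]
  omega

theorem worstTime_worstNode (t : Fin P.excess) : worstTime (worstNode hl hk t) = t := by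
  simp only [worstTime, worstNode, Nat.add_sub_cancel_left, Nat.div_add_mod']

theorem worstNode_injective : Function.Injective (worstNode hl hk) := fun t t' h => by
  rw [Fin.ext_iff, ← worstTime_worstNode hl hk t, h, worstTime_worstNode]

theorem worstNode_eq_of_worstTime_eq {v : P.Node} (hv : P.l ≤ v.2) {t : Fin P.excess}
    (h : worstTime v = t) : worstNode hl hk t = v := by
  have hv2 := v.2.2
  rw [worstTime, mul_comm] at h
  refine Prod.ext (Fin.ext ?_) (Fin.ext ?_)
  · change t / (P.u - P.l) = v.1.val
    rw [← h, Nat.mul_add_div (by omega), Nat.div_eq_of_lt (by omega), add_zero]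
  · change P.l + t % (P.u - P.l) = v.2.val
    rw [← h, Nat.mul_add_mod, Nat.mod_eq_of_lt (by omega), Nat.add_sub_cancel' hv]

include hl in
theorem worstTime_lt_excess {v : P.Node} (hv : v ∈ firstNodes P) (hlv : P.l ≤ v.2) :
    worstTime v < P.excess := by
  have hv2 := v.2.2
  rw [mem_firstNodes, ← P.kbar_mul_u_add_u0] at hv
  rw [worstTime, Params.excess]
  rcases lt_trichotomy v.1.val P.kbar with h | h | h
  · have := mul_add_self_le_mul_of_lt h (P.u - P.l)
    omega
  · rw [h] at hv ⊢
    omega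
  · have := mul_add_self_le_mul_of_lt h P.u
    have := P.u0_lt_u hl
    omega

include hl hk in
theorem card_filter_firstNodes_le :
    ((firstNodes P).filter fun v => v.2.val < P.l).card ≤ P.core := by
  have hexcess : P.excess ≤ ((firstNodes P).filter fun v => ¬ v.2.val < P.l).card := by
    simpa using Finset.card_le_card_of_injOn (s := Finset.univ) (worstNode hl hk)
      (fun t _ => Finset.mem_filter.2 ⟨worstNode_mem_firstNodes hl hk t, by simp [worstNode]⟩)
      (worstNode_injective hl hk).injOn
  have hsplit := Finset.card_filter_add_card_filter_not (s := firstNodes P) (·.2.val < P.l)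
  rw [card_firstNodes hk, ← P.core_add_excess hl] at hsplit
  omega

end Order

end WorstCase

section WorstCut

variable {P : Params}

theorem exists_of_capacity_eq_top {T : ℕ} {r : Fin T → Repair P} {a b : Vertex P T}
    (h : capacity r a b = ⊤) :
    (∃ v, b = .origIn v) ∨
    (∃ t, ∃ g ∈ (r t).localHelpers, a = .out t.castSucc ((r t).rack, g) ∧ b = .newIn t) ∨
    (∃ t v, a = .out t.castSucc v ∧ b = .gate t v.1) ∨
    (∃ t v, v ≠ (r t).node ∧ a = .out t.castSucc v ∧ b = .out t.succ v) ∨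
    ∃ t K, ∃ v ∈ K, a = .out t v ∧ b = .collector t K := by
  cases a <;> cases b <;> simp only [capacity, ENat.zero_ne_top] at h <;>
    try (split_ifs at h with hif <;> simp only [ENat.zero_ne_top, ENat.natCast_ne_top] at h)
  · exact Or.inl ⟨_, rfl⟩
  · obtain ⟨rfl, hrack, hg⟩ := hif
    exact Or.inr (Or.inl ⟨_, _, hg, by rw [← hrack], rfl⟩)
  · obtain ⟨t, rfl, rfl, rfl, hne⟩ := hif
    exact Or.inr (Or.inr (Or.inr (Or.inl ⟨t, _, hne, rfl, rfl⟩)))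
  · obtain ⟨rfl, -, rfl⟩ := hif
    exact Or.inr (Or.inr (Or.inl ⟨_, _, rfl, rfl⟩))
  · obtain ⟨rfl, hv⟩ := hif
    exact Or.inr (Or.inr (Or.inr (Or.inr ⟨_, _, _, hv, rfl, rfl⟩)))

variable (hl : P.l < P.u) (hk : P.k ≤ P.nbar * P.u) (hd : P.dbar < P.nbar)

/-- The repairs of the nodes `worstNode t` in their order. The racks that have been repaired
completely help, as far as `P.dbar` permits. -/
def worstRepair (t : Fin P.excess) : Repair P where
  rack := (worstNode hl hk t).1
  pos := (worstNode hl hk t).2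
  localHelpers := Finset.univ.filter fun g => g.val < P.l
  helperRacks := (Finset.univ.filter fun h : Fin P.nbar => h.val < P.dbar + 1).erase
    ⟨min (t / (P.u - P.l)) P.dbar, (min_le_right _ _).trans_lt hd⟩
  pos_notMem := by simp [worstNode]
  card_localHelpers := by rw [Fin.card_filter_val_lt, min_eq_right hl.le]
  rack_notMem := by
    simp only [worstNode, Finset.mem_erase, Finset.mem_filter, Finset.mem_univ, true_and, ne_eq,
      Fin.ext_iff, not_and]
    omega
  card_helperRacks := by
    rw [Finset.card_erase_of_mem (by simp), Fin.card_filter_val_lt, min_eq_right hd,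
      Nat.add_sub_cancel]

theorem mem_helperRacks_worstRepair {t : Fin P.excess} {h : Fin P.nbar} :
    h ∈ (worstRepair hl hk hd t).helperRacks ↔
      h.val ≠ min (t / (P.u - P.l)) P.dbar ∧ h.val ≤ P.dbar := by
  simp [worstRepair, Fin.ext_iff]

/-- The side of the data collector in a minimum cut for `worstRepair`. It contains a node of
`firstNodes P` as soon as it has been repaired for the last time, and its 'in' vertex if the uploads
from the racks that have not been repaired yet are cheaper than storing `α` symbols. -/
def WorstSink : Vertex P P.excess → Prop
  | .source => False
  | .origIn _ => False
  | .newIn t => (P.dbar - t / (P.u - P.l)) * P.β < P.α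
  | .out t v => v ∈ firstNodes P ∧ (v.2.val < P.l ∨ worstTime v < t)
  | .gate t h => h.val < t / (P.u - P.l)
  | .collector t K => t = Fin.last _ ∧ K = firstNodes P

variable {hl hk hd}

theorem worstSink_of_capacity_eq_top {a b : Vertex P P.excess}
    (h : capacity (worstRepair hl hk hd) a b = ⊤) (hb : WorstSink b) : WorstSink a := by
  rcases exists_of_capacity_eq_top h with ⟨v, rfl⟩ | ⟨t, g, hg, rfl, rfl⟩ | ⟨t, v, rfl, rfl⟩ |
    ⟨t, v, hne, rfl, rfl⟩ | ⟨t, K, v, hv, rfl, rfl⟩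
  · exact hb.elim
  · have hgl : g.val < P.l := (Finset.mem_filter.1 hg).2
    refine ⟨mem_firstNodes.2 (lt_of_le_of_lt ?_ (div_mul_add_mod_lt hl t.2)), Or.inl hgl⟩
    exact Nat.add_le_add_left (hgl.le.trans (Nat.le_add_right _ _)) _
  · exact ⟨mem_firstNodes_of_lt (worstNode_mem_firstNodes hl hk t) hb,
      Or.inr (worstTime_lt_of_lt_div hl hb)⟩
  · refine ⟨hb.1, or_iff_not_imp_left.2 fun hvl => ?_⟩
    have hlt := hb.2.resolve_left hvl
    have htime : worstTime v ≠ t := fun heq =>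
      hne (worstNode_eq_of_worstTime_eq hl hk (not_lt.1 hvl) heq).symm
    rw [Fin.val_succ] at hlt
    rw [Fin.val_castSucc]
    omega
  · obtain ⟨rfl, rfl⟩ := hb
    exact ⟨hv, (lt_or_ge _ _).imp_right (worstTime_lt_excess hl hv)⟩

open Classical in
/-- The side of the source in a minimum cut for `worstRepair`. -/
noncomputable def worstCut (P : Params) : Finset (Vertex P P.excess) :=
  Finset.univ.filter fun a => ¬ WorstSink a

theorem notMem_worstCut {a : Vertex P P.excess} : a ∉ worstCut P ↔ WorstSink a := by
  simp [worstCut]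

theorem mem_worstCut {a : Vertex P P.excess} : a ∈ worstCut P ↔ ¬ WorstSink a := by
  simp [worstCut]

/-- The capacity that an edge of finite capacity contributes to the cut `worstCut P`. -/
noncomputable def cutWidth (i : Link (worstRepair hl hk hd)) : ℕ :=
  if i ∈ cutLinks (worstRepair hl hk hd) (worstCut P) then width _ i else 0

theorem sum_cutWidth_le {κ : Type*} [Fintype κ] (f : κ → Link (worstRepair hl hk hd)) {w : ℕ}
    (hw : ∀ i, width _ (f i) ≤ w) (S : Finset κ)
    (hS : ∀ i, f i ∈ cutLinks (worstRepair hl hk hd) (worstCut P) → i ∈ S) :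
    ∑ i, cutWidth (f i) ≤ S.card * w := by
  classical
  calc ∑ i, cutWidth (f i) ≤ ∑ i, if i ∈ S then w else 0 := Finset.sum_le_sum fun i _ => by
        rw [cutWidth]
        split_ifs with hcut hi hi
        exacts [hw i, absurd (hS i hcut) hi, Nat.zero_le _, le_rfl]
    _ = S.card * w := by rw [Finset.sum_ite_mem, Finset.univ_inter, Finset.sum_const, smul_eq_mul]

theorem sum_store_cutWidth_le :
    ∑ v, cutWidth (.inl v : Link (worstRepair hl hk hd)) ≤ P.core * P.α := by
  refine (sum_cutWidth_le (fun v => .inl v) (fun _ => le_rfl)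
    ((firstNodes P).filter fun v => v.2.val < P.l) fun v hv => ?_).trans
    (Nat.mul_le_mul_right _ (card_filter_firstNodes_le hl hk))
  have hout := notMem_worstCut.1 (mem_cutLinks.1 hv).2
  exact Finset.mem_filter.2 ⟨hout.1, hout.2.resolve_right (Nat.not_lt_zero _)⟩

theorem sum_upload_cutWidth_le (t : Fin P.excess) :
    ∑ h, cutWidth (.inr (.inr ⟨t, h⟩) : Link (worstRepair hl hk hd)) ≤
      (P.dbar - t / (P.u - P.l)) * P.β := by
  refine (sum_cutWidth_le (fun h => .inr (.inr ⟨t, h⟩)) (fun _ => le_rfl)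
    (Finset.univ.filter fun h => t / (P.u - P.l) ≤ h.1.val) fun h hh => ?_).trans
    (Nat.mul_le_mul_right _ ?_)
  · exact Finset.mem_filter.2
      ⟨Finset.mem_univ h, not_lt.1 fun hlt => mem_worstCut.1 (mem_cutLinks.1 hh).1 hlt⟩
  · rw [← Nat.card_Ioc (t / (P.u - P.l)) P.dbar]
    refine Finset.card_le_card_of_injOn (Fin.val ∘ Subtype.val) (fun h hh => ?_)
      (Fin.val_injective.comp Subtype.val_injective).injOn
    have hhelper := (mem_helperRacks_worstRepair hl hk hd).1 h.2
    have hle := (Finset.mem_filter.1 hh).2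
    rw [Finset.coe_Ioc, Set.mem_Ioc, Function.comp_apply]
    omega

theorem repair_cutWidth_le (t : Fin P.excess) :
    cutWidth (.inr (.inl t) : Link (worstRepair hl hk hd)) +
        ∑ h, cutWidth (.inr (.inr ⟨t, h⟩) : Link (worstRepair hl hk hd)) ≤
      P.weight (t / (P.u - P.l)) := by
  have hupload := sum_upload_cutWidth_le (hl := hl) (hk := hk) (hd := hd) t
  by_cases hsink : WorstSink (.newIn t)
  · have hrestore : cutWidth (.inr (.inl t) : Link (worstRepair hl hk hd)) = 0 :=
      if_neg fun hcut => absurd hsink (mem_worstCut.1 (mem_cutLinks.1 hcut).1)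
    rw [hrestore, zero_add]
    exact le_min hupload (hupload.trans (le_of_lt hsink))
  · have hzero (h) : cutWidth (.inr (.inr ⟨t, h⟩) : Link (worstRepair hl hk hd)) = 0 :=
      if_neg fun hcut => hsink (notMem_worstCut.1 (mem_cutLinks.1 hcut).2)
    have hrestore : cutWidth (.inr (.inl t) : Link (worstRepair hl hk hd)) ≤ P.α := by
      rw [cutWidth]
      split_ifs
      exacts [le_rfl, Nat.zero_le _]
    simp only [hzero, Finset.sum_const_zero, add_zero]
    exact le_min (hrestore.trans (not_lt.1 hsink)) hrestore

theorem exists_mem_minCuts_le (hl : P.l < P.u) (hk : P.k ≤ P.nbar * P.u) (hd : P.dbar < P.nbar) :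
    ∃ c ∈ minCuts P, c ≤ P.maxFileSize := by
  refine ⟨_, ⟨_, worstRepair hl hk hd, Fin.last _, firstNodes P, card_firstNodes hk, rfl⟩, ?_⟩
  calc _ ≤ ∑ a ∈ worstCut P, ∑ b ∈ (worstCut P)ᶜ, capacity (worstRepair hl hk hd) a b :=
        iInf₂_le _ ⟨mem_worstCut.2 id, notMem_worstCut.2 ⟨rfl, rfl⟩⟩
    _ = (∑ i, cutWidth (i : Link (worstRepair hl hk hd)) : ℕ) := by
        rw [sum_capacity_eq fun a ha b hb htop => mem_worstCut.1 ha
          (worstSink_of_capacity_eq_top htop (notMem_worstCut.1 hb))]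
        simp only [cutWidth, Finset.sum_ite_mem, Finset.univ_inter]
    _ ≤ P.maxFileSize := by
        rw [Fintype.sum_sum_type, Fintype.sum_sum_type, Fintype.sum_sigma,
          ← Finset.sum_add_distrib, Nat.cast_le, Params.maxFileSize, ← Fin.sum_univ_eq_sum_range]
        exact Nat.add_le_add sum_store_cutWidth_le
          (Finset.sum_le_sum fun t _ => repair_cutWidth_le t)

end WorstCut

end RackStorage

theorem theorem1_general (P : RackStorage.Params)
    (hl : P.l < P.u) (hk : P.k ≤ P.nbar * P.u) (hd : P.dbar < P.nbar)
    (Bstar : ℕ)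
    (hBstar : Bstar = (P.kbar * P.l + min P.u0 P.l) * P.α
      + (P.u - P.l) * ∑ j ∈ Finset.range P.kbar, min ((P.dbar - j) * P.β) P.α
      + (P.u0 - P.l) * min ((P.dbar - P.kbar) * P.β) P.α) :
    IsGreatest {B : ℕ | RackStorage.AttainableOffline P B} Bstar ∧
    IsGreatest {B : ℕ | RackStorage.AttainableOnline P B} Bstar ∧
    IsLeast (RackStorage.minCuts P) (Bstar : ℕ∞) := by
  obtain rfl : Bstar = P.maxFileSize := hBstar.trans (P.maxFileSize_eq hl).symm
  have hattain := RackStorage.attainableOnline_maxFileSize hl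
  obtain ⟨c, hc, hle⟩ := RackStorage.exists_mem_minCuts_le hl hk hd
  have hupper {B : ℕ} (h : RackStorage.AttainableOffline P B) : B ≤ P.maxFileSize := by
    exact_mod_cast (h.le_of_mem_minCuts hc).trans hle
  refine ⟨⟨hattain.offline, fun B h => hupper h⟩, ⟨hattain, fun B h => hupper h.offline⟩, ?_,
    fun c h => hattain.offline.le_of_mem_minCuts h⟩
  rwa [← le_antisymm hle (hattain.offline.le_of_mem_minCuts hc)]

theorem theorem1 (P : RackStorage.Params)
    (hl : P.l < P.u) (hk : P.k ≤ P.nbar * P.u) (hd : P.dbar < P.kbar)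
    (Bstar : ℕ)
    (hBstar : Bstar = (P.kbar * P.l + min P.u0 P.l) * P.α
      + (P.u - P.l) * ∑ i ∈ Finset.Icc 1 P.dbar, min (i * P.β) P.α) :
    IsGreatest {B : ℕ | RackStorage.AttainableOffline P B} Bstar ∧
    IsGreatest {B : ℕ | RackStorage.AttainableOnline P B} Bstar ∧
    IsLeast (RackStorage.minCuts P) (Bstar : ℕ∞) :=
  theorem1_general P hl hk (hd.trans_le (Nat.div_le_of_le_mul (by rwa [mul_comm]))) Bstar (by
    simpa [RackStorage.sum_range_min_sub_mul hd.le, Nat.sub_eq_zero_of_le hd.le] using hBstar)
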